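/- Let $N\ge 1$, let $\Omega\subset\mathbb R^N$ be a bounded open set with $C^2$ boundary, and let $V\colon\mathbb R^N\to\mathbb R$ be a bounded measurable function such that (1) $0\le V\le 1$ a.e. in $\mathbb R^N$; (2) $V=0$ a.e. in $\overline\Omega$; (3) $\operatorname{ess\,inf}\{V(x)\mid x\in\overline{B_r(x_0)}\}>0$ for every closed ball $\overline{B_r(x_0)}\subset\mathbb R^N\setminus\overline\Omega$ ($r>0$); (4) $\operatorname{ess\,lim}_{|x|\to\infty}V(x)=1$. All functions are real valued. For $\beta\ge 0$ put $$\langle u,v\rangle_{1,\beta}=\int_{\mathbb R^N}\nabla u\cdot\nabla v\,dx+\int_{\mathbb R^N}(1+\beta V)\,uv\,dx\quad(u,v\in H^1(\mathbb R^N)),\qquad \|u\|_{1,\beta}=\langle u,u\rangle_{1,\beta}^{1/2}.$$ Let $L^2_\Omega$ and $H^1_\Omega$ be the subspaces of those $u\in L^2(\mathbb R^N)$, respectively $u\in H^1(\mathbb R^N)$, with $u=0$ a.e. in $\mathbb R^N\setminus\Omega$ (they are naturally identified with $L^2(\Omega)$ and $H^1_0(\Omega)$). Let $A_\beta$ be the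 operator in $L^2(\mathbb R^N)$ such that $u\in D(A_\beta)$ and $A_\beta u=w\in L^2(\mathbb R^N)$ if and only if $u\in H^1(\mathbb R^N)$ and $\langle w,v\rangle_{L^2}=\langle u,v\rangle_{1,\beta}$ for all $v\in H^1(\mathbb R^N)$ (so $A_\beta=-\Delta+1+\beta V$), and let $A_\Omega$ be the operator in $L^2_\Omega$ such that $u\in D(A_\Omega)$ and $A_\Omega u=w\in L^2_\Omega$ if and only if $u\in H^1_\Omega$ and $\langle w,v\rangle_{L^2}=\langle u,v\rangle_{H^1}$ for all $v\in H^1_\Omega$ (so $A_\Omega=-\Delta+1$ in $\Omega$ with Dirichlet boundary condition). **Theorem.** Let $(\beta_n)$ be a sequence of positive numbers with $\beta_n\to+\infty$, let $f_n\to f$ strongly in $L^2(\mathbb R^N)$ with $f\in L^2_\Omega$, and let $\lambda>-1$. (a) For every $n$ there is exactly one weak solution $u_n$ of $A_{\beta_n}u+\lambda u=f_n$, that is, exactly one $u_n\in H^1(\mathbb R^N)$ with $\langle u_n,\varphi\rangle_{1,\beta_n}+\lambda\int u_n\varphi\,dx=\int f_n\varphi\,dx$ for all $\varphi\in H^1(\mathbb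 R^N)$; and there is exactly one weak solution $u_\Omega$ of $A_\Omega u+\lambda u=f$, that is, exactly one $u_\Omega\in H^1_\Omega$ with $\langle u_\Omega,\varphi\rangle_{H^1}+\lambda\int u_\Omega\varphi\,dx=\int f\varphi\,dx$ for all $\varphi\in H^1_\Omega$. (b) Up to a subsequence, $\|u_n-u_\Omega\|_{1,\beta_n}\to 0$ as $n\to\infty$. (c) The operators $-A_{\beta_n}-\lambda I$ in $L^2(\mathbb R^N)$ and $-A_\Omega-\lambda I$ in $L^2_\Omega$ have bounded everywhere defined inverses, with $(-A_{\beta_n}-\lambda I)^{-1}f_n\in H^1(\mathbb R^N)$ and $(-A_\Omega-\lambda I)^{-1}f\in H^1(\mathbb R^N)$, and, along the whole sequence, $$\|(-A_{\beta_n}-\lambda I)^{-1}f_n-(-A_\Omega-\lambda I)^{-1}f\|_{1,\beta_n}\to 0\quad\text{as } n\to\infty.$$ -/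

import Mathlib

open MeasureTheory Filter Topology Set
open scoped ContDiff ENNReal

noncomputable section

namespace WellPotential

/-! ### Function spaces on `ℝ^N` -/

/-- Euclidean space `ℝ^N`. -/
abbrev RN (N : ℕ) : Type := EuclideanSpace ℝ (Fin N)

/-- The real Hilbert space `L²(ℝ^N)`. -/
abbrev L2 (N : ℕ) : Type := Lp ℝ 2 (volume : Measure (RN N))

/-- The Hilbert space `L²(ℝ^N; ℝ^N)` of square integrable vector fields. -/
abbrev L2Vec (N : ℕ) : Type := Lp (RN N) 2 (volume : Measure (RN N))

/-- `g` is the weak (distributional) gradient of `u`: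
`∫ u ∂ᵢφ = - ∫ gᵢ φ` for every test function `φ ∈ C_c^∞(ℝ^N)` and every `i`. -/
def HasWeakGrad {N : ℕ} (u : L2 N) (g : L2Vec N) : Prop :=
  ∀ φ : RN N → ℝ, ContDiff ℝ ∞ φ → HasCompactSupport φ → ∀ i : Fin N,
    ∫ x, u x * fderiv ℝ φ x (EuclideanSpace.single i 1) = - ∫ x, g x i * φ x

lemma integrable_mul {N : ℕ} {f g : RN N → ℝ} (hf : MemLp f 2) (hg : MemLp g 2) :
    Integrable (fun x => f x * g x) :=
  hf.integrable_mul hg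

lemma memLp_coord {N : ℕ} (g : L2Vec N) (i : Fin N) :
    MemLp (fun x => g x i) 2 (volume : Measure (RN N)) :=
  (EuclideanSpace.proj i : RN N →L[ℝ] ℝ).comp_memLp' (Lp.memLp g)

lemma memLp_test {N : ℕ} {φ : RN N → ℝ} (hφ : ContDiff ℝ ∞ φ) (hc : HasCompactSupport φ) :
    MemLp φ 2 (volume : Measure (RN N)) :=
  hφ.continuous.memLp_of_hasCompactSupport hc

lemma memLp_fderiv_test {N : ℕ} {φ : RN N → ℝ} (hφ : ContDiff ℝ ∞ φ)
    (hc : HasCompactSupport φ) (v : RN N) :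
    MemLp (fun x => fderiv ℝ φ x v) 2 (volume : Measure (RN N)) :=
  ((hφ.continuous_fderiv (by simp)).clm_apply
    continuous_const).memLp_of_hasCompactSupport (hc.fderiv_apply (𝕜 := ℝ) v)

lemma HasWeakGrad.add {N : ℕ} {u v : L2 N} {g h : L2Vec N}
    (hu : HasWeakGrad u g) (hv : HasWeakGrad v h) : HasWeakGrad (u + v) (g + h) := by
  intro φ hφ hc i
  have e1 : ∫ x, (u + v : L2 N) x * fderiv ℝ φ x (EuclideanSpace.single i 1)
      = ∫ x, (u x * fderiv ℝ φ x (EuclideanSpace.single i 1)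
        + v x * fderiv ℝ φ x (EuclideanSpace.single i 1)) := by
    apply integral_congr_ae
    filter_upwards [Lp.coeFn_add u v] with x hx
    rw [hx, Pi.add_apply, add_mul]
  have e2 : ∫ x, (g + h : L2Vec N) x i * φ x = ∫ x, (g x i * φ x + h x i * φ x) := by
    apply integral_congr_ae
    filter_upwards [Lp.coeFn_add g h] with x hx
    rw [hx, Pi.add_apply, PiLp.add_apply, add_mul]
  rw [e1, e2,
    integral_add (integrable_mul (Lp.memLp u) (memLp_fderiv_test hφ hc _))
      (integrable_mul (Lp.memLp v) (memLp_fderiv_test hφ hc _)),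
    integral_add (integrable_mul (memLp_coord g i) (memLp_test hφ hc))
      (integrable_mul (memLp_coord h i) (memLp_test hφ hc)),
    hu φ hφ hc i, hv φ hφ hc i]
  ring

lemma HasWeakGrad.smul {N : ℕ} (c : ℝ) {u : L2 N} {g : L2Vec N}
    (hu : HasWeakGrad u g) : HasWeakGrad (c • u) (c • g) := by
  intro φ hφ hc i
  have e1 : ∫ x, (c • u : L2 N) x * fderiv ℝ φ x (EuclideanSpace.single i 1)
      = ∫ x, c * (u x * fderiv ℝ φ x (EuclideanSpace.single i 1)) := by
    apply integral_congr_ae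
    filter_upwards [Lp.coeFn_smul c u] with x hx
    rw [hx, Pi.smul_apply, smul_eq_mul, mul_assoc]
  have e2 : ∫ x, (c • g : L2Vec N) x i * φ x = ∫ x, c * (g x i * φ x) := by
    apply integral_congr_ae
    filter_upwards [Lp.coeFn_smul c g] with x hx
    rw [hx, Pi.smul_apply, PiLp.smul_apply, smul_eq_mul, mul_assoc]
  rw [e1, e2, integral_const_mul, integral_const_mul, hu φ hφ hc i]
  ring

lemma HasWeakGrad.zero {N : ℕ} : HasWeakGrad (0 : L2 N) (0 : L2Vec N) := by
  have h : ∀ (u : L2 N) (g : L2Vec N), u = 0 → g = 0 → HasWeakGrad u g := by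
    rintro u g rfl rfl φ hφ hc i
    have e1 : ∫ x, (0 : L2 N) x * fderiv ℝ φ x (EuclideanSpace.single i 1) = 0 := by
      rw [integral_eq_zero_of_ae]
      filter_upwards [Lp.coeFn_zero ℝ 2 (volume : Measure (RN N))] with x hx
      rw [hx]; simp
    have e2 : ∫ x, (0 : L2Vec N) x i * φ x = 0 := by
      rw [integral_eq_zero_of_ae]
      filter_upwards [Lp.coeFn_zero (RN N) 2 (volume : Measure (RN N))] with x hx
      rw [hx]; simp
    rw [e1, e2, neg_zero]
  exact h 0 0 rfl rfl

/-- The weak gradient is unique. -/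
lemma HasWeakGrad.unique {N : ℕ} {u : L2 N} {g h : L2Vec N}
    (hg : HasWeakGrad u g) (hh : HasWeakGrad u h) : g = h := by
  have key : ∀ i : Fin N, ∀ᵐ x, g x i = h x i := by
    intro i
    refine ae_eq_of_integral_contDiff_smul_eq
      ((memLp_coord g i).locallyIntegrable (by norm_num))
      ((memLp_coord h i).locallyIntegrable (by norm_num)) ?_
    intro φ hφ hc
    have := (hg φ hφ hc i).symm.trans (hh φ hφ hc i)
    simp only [smul_eq_mul, mul_comm (φ _)]
    linarith
  apply Lp.ext
  filter_upwards [ae_all_iff.2 key] with x hx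
  ext i
  exact hx i

/-- The Sobolev space `H¹(ℝ^N)`: all `u ∈ L²` with a weak gradient in `L²`. -/
def H1 (N : ℕ) : Submodule ℝ (L2 N) where
  carrier := {u | ∃ g : L2Vec N, HasWeakGrad u g}
  add_mem' := by
    rintro u v ⟨g, hg⟩ ⟨h, hh⟩
    exact ⟨g + h, hg.add hh⟩
  zero_mem' := ⟨0, HasWeakGrad.zero⟩
  smul_mem' := by
    rintro c u ⟨g, hg⟩
    exact ⟨c • g, hg.smul c⟩

/-- The weak gradient `∇ : H¹(ℝ^N) → L²(ℝ^N; ℝ^N)`. -/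
def weakGrad {N : ℕ} : H1 N →ₗ[ℝ] L2Vec N where
  toFun u := Classical.choose u.2
  map_add' u v := (Classical.choose_spec (u + v).2).unique
    ((Classical.choose_spec u.2).add (Classical.choose_spec v.2))
  map_smul' c u := (Classical.choose_spec (c • u).2).unique
    ((Classical.choose_spec u.2).smul c)

lemma weakGrad_spec {N : ℕ} (u : H1 N) : HasWeakGrad (u : L2 N) (weakGrad u) :=
  Classical.choose_spec u.2

/-- `L²_Ω(ℝ^N)`: the `u ∈ L²(ℝ^N)` with `u = 0` a.e. in `ℝ^N ∖ Ω`. -/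
def L2Ω {N : ℕ} (Ω : Set (RN N)) : Submodule ℝ (L2 N) where
  carrier := {u | ∀ᵐ x, x ∉ Ω → u x = 0}
  add_mem' := by
    intro u v hu hv
    simp only [mem_ofPred_eq] at *
    filter_upwards [hu, hv, Lp.coeFn_add u v] with x h1 h2 h3 hx
    rw [h3, Pi.add_apply, h1 hx, h2 hx, add_zero]
  zero_mem' := by
    simp only [mem_ofPred_eq]
    filter_upwards [Lp.coeFn_zero ℝ 2 (volume : Measure (RN N))] with x h _
    rw [h, Pi.zero_apply]
  smul_mem' := by
    intro c u hu
    simp only [mem_ofPred_eq] at *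
    filter_upwards [hu, Lp.coeFn_smul c u] with x h1 h2 hx
    rw [h2, Pi.smul_apply, h1 hx, smul_zero]

/-- `H¹_Ω(ℝ^N)`: the `u ∈ H¹(ℝ^N)` with `u = 0` a.e. in `ℝ^N ∖ Ω`. -/
def H1Ω {N : ℕ} (Ω : Set (RN N)) : Submodule ℝ (H1 N) :=
  (L2Ω Ω).comap (H1 N).subtype

/-! ### Domains with `C²` boundary and well potentials -/

/-- `Ω` has `C²` boundary: near every boundary point there is a `C²` diffeomorphism between open
subsets of `ℝ^N` that maps `Ω` to an open half space and `∂Ω` to the bounding hyperplane. -/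
def HasC2Boundary {N : ℕ} (Ω : Set (RN N)) : Prop :=
  ∀ x₀ ∈ frontier Ω, ∃ (ψ : OpenPartialHomeomorph (RN N) (RN N)) (i : Fin N),
    x₀ ∈ ψ.source ∧ ContDiffOn ℝ 2 ψ ψ.source ∧ ContDiffOn ℝ 2 ψ.symm ψ.target ∧
      ∀ x ∈ ψ.source, (x ∈ Ω ↔ 0 < ψ x i) ∧ (x ∈ frontier Ω ↔ ψ x i = 0)

/-- The standing assumption on the potential `V` relative to `Ω`. -/
structure IsWellPotential {N : ℕ} (Ω : Set (RN N)) (V : RN N → ℝ) : Prop where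
  /-- `0 ≤ V ≤ 1` almost everywhere -/
  bounds : ∀ᵐ x, 0 ≤ V x ∧ V x ≤ 1
  /-- `V = 0` almost everywhere in the closure of `Ω` -/
  zero_on : ∀ᵐ x, x ∈ closure Ω → V x = 0
  /-- the essential infimum of `V` is positive on closed balls outside the closure of `Ω` -/
  essInf_pos : ∀ (x₀ : RN N) (r : ℝ), 0 < r → Metric.closedBall x₀ r ⊆ (closure Ω)ᶜ →
    0 < essInf V (volume.restrict (Metric.closedBall x₀ r))
  /-- `ess lim V(x) = 1` as `|x| → ∞` -/
  esslim : Tendsto V (cocompact (RN N) ⊓ ae volume) (𝓝 1)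

/-! ### The bilinear forms and the norm `‖·‖_{1,β}` -/

/-- `V_β(x) = 1 + β V(x)`. -/
def Vβ {N : ℕ} (V : RN N → ℝ) (β : ℝ) (x : RN N) : ℝ := 1 + β * V x

/-- `a_β(u,v) = ∫ ∇u·∇v + ∫ V_β u v`, the scalar product `⟨u,v⟩_{1,β}` on `H¹(ℝ^N)`. -/
def formA {N : ℕ} (V : RN N → ℝ) (β : ℝ) (u v : H1 N) : ℝ :=
  (∫ x, inner ℝ (weakGrad u x) (weakGrad v x)) + ∫ x, Vβ V β x * (u : L2 N) x * (v : L2 N) x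

/-- The norm `‖u‖_{1,β} = ⟨u,u⟩_{1,β}^{1/2}`. -/
def normβ {N : ℕ} (V : RN N → ℝ) (β : ℝ) (u : H1 N) : ℝ := Real.sqrt (formA V β u u)

/-- The standard scalar product of `H¹(ℝ^N)`, `∫ ∇u·∇v + ∫ u v`. -/
def innerH1 {N : ℕ} (u v : H1 N) : ℝ :=
  (∫ x, inner ℝ (weakGrad u x) (weakGrad v x)) + ∫ x, (u : L2 N) x * (v : L2 N) x

/-- `u ∈ H¹(ℝ^N)` is a weak solution of `A_β u + λ u = f`, i.e. of
`-Δu + V_β u + λ u = f` in `ℝ^N`. -/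
def IsWeakSol {N : ℕ} (V : RN N → ℝ) (β lam : ℝ) (f : L2 N) (u : H1 N) : Prop :=
  ∀ φ : H1 N, formA V β u φ + lam * ∫ x, (u : L2 N) x * (φ : L2 N) x
    = ∫ x, f x * (φ : L2 N) x

/-- `u ∈ H¹_Ω(ℝ^N)` is a weak solution of `A_Ω u + λ u = f`, i.e. of
`-Δu + u + λ u = f` in `Ω`, `u = 0` on `∂Ω`. -/
def IsWeakSolΩ {N : ℕ} (Ω : Set (RN N)) (lam : ℝ) (f : L2 N) (u : H1 N) : Prop :=
  u ∈ H1Ω Ω ∧ ∀ φ ∈ H1Ω Ω, innerH1 u φ + lam * ∫ x, (u : L2 N) x * (φ : L2 N) x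
    = ∫ x, f x * (φ : L2 N) x

/-! ### The operators `A_β`, `A_Ω` and their resolvents -/

lemma integrable_pot {N : ℕ} {V : RN N → ℝ} (hm : Measurable V) (hb : ∃ M, ∀ x, |V x| ≤ M)
    (β : ℝ) (u v : L2 N) : Integrable (fun x => Vβ V β x * u x * v x) := by
  obtain ⟨M, hM⟩ := hb
  have h := (integrable_mul (Lp.memLp u) (Lp.memLp v)).bdd_mul (c := 1 + |β| * M)
    (f := Vβ V β) (measurable_const.add (hm.const_mul β)).aestronglyMeasurable
    (ae_of_all _ fun x => by
      rw [Real.norm_eq_abs, Vβ]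
      refine (abs_add_le _ _).trans ?_
      rw [abs_one, abs_mul]
      gcongr
      exact hM x)
  simpa only [mul_assoc] using h

lemma integral_inner_eq {N : ℕ} (g h : L2Vec N) : ∫ x, inner ℝ (g x) (h x) = inner ℝ g h := rfl

lemma formA_add_left {N : ℕ} {V : RN N → ℝ} (hm : Measurable V) (hb : ∃ M, ∀ x, |V x| ≤ M)
    (β : ℝ) (u v w : H1 N) : formA V β (u + v) w = formA V β u w + formA V β v w := by
  have e : ∫ x, Vβ V β x * ((u + v : H1 N) : L2 N) x * (w : L2 N) x
      = ∫ x, (Vβ V β x * (u : L2 N) x * (w : L2 N) x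
        + Vβ V β x * (v : L2 N) x * (w : L2 N) x) := by
    apply integral_congr_ae
    filter_upwards [Lp.coeFn_add (u : L2 N) (v : L2 N)] with x hx
    rw [Submodule.coe_add, hx, Pi.add_apply]; ring
  simp only [formA, integral_inner_eq, map_add, inner_add_left]
  rw [e, integral_add (integrable_pot hm hb β _ _) (integrable_pot hm hb β _ _)]
  ring

lemma formA_smul_left {N : ℕ} (V : RN N → ℝ) (β c : ℝ) (u w : H1 N) :
    formA V β (c • u) w = c * formA V β u w := by
  have e : ∫ x, Vβ V β x * ((c • u : H1 N) : L2 N) x * (w : L2 N) x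
      = ∫ x, c * (Vβ V β x * (u : L2 N) x * (w : L2 N) x) := by
    apply integral_congr_ae
    filter_upwards [Lp.coeFn_smul c (u : L2 N)] with x hx
    rw [Submodule.coe_smul, hx, Pi.smul_apply, smul_eq_mul]; ring
  simp only [formA, integral_inner_eq, map_smul, real_inner_smul_left]
  rw [e, integral_const_mul]
  ring

lemma innerH1_eq {N : ℕ} (u v : H1 N) : innerH1 u v = formA 0 0 u v := by
  simp [innerH1, formA, Vβ]

lemma innerH1_add_left {N : ℕ} (u v w : H1 N) :
    innerH1 (u + v) w = innerH1 u w + innerH1 v w := by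
  simp only [innerH1_eq]
  exact formA_add_left measurable_zero ⟨0, by simp⟩ 0 u v w

lemma innerH1_smul_left {N : ℕ} (c : ℝ) (u w : H1 N) :
    innerH1 (c • u) w = c * innerH1 u w := by
  simp only [innerH1_eq, formA_smul_left]

/-- The graph of `A_β`, the part in `L²(ℝ^N)` of the operator induced by `⟨·,·⟩_{1,β}`:
`u ∈ D(A_β)` and `A_β u = w` iff `u ∈ H¹(ℝ^N)`, `w ∈ L²(ℝ^N)` and
`⟨w, v⟩_{L²} = a_β(u, v)` for all `v ∈ H¹(ℝ^N)`. -/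
def graphA {N : ℕ} (V : RN N → ℝ) (hm : Measurable V) (hb : ∃ M, ∀ x, |V x| ≤ M) (β : ℝ) :
    Submodule ℝ (L2 N × L2 N) where
  carrier := {p | ∃ hu : p.1 ∈ H1 N, ∀ v : H1 N, inner ℝ p.2 (v : L2 N) = formA V β ⟨p.1, hu⟩ v}
  add_mem' := by
    rintro p q ⟨hp, h1⟩ ⟨hq, h2⟩
    refine ⟨(H1 N).add_mem hp hq, fun v => ?_⟩
    rw [Prod.snd_add, inner_add_left, h1, h2, ← formA_add_left hm hb]
    rfl
  zero_mem' := by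
    refine ⟨(H1 N).zero_mem, fun v => ?_⟩
    have := formA_smul_left V β 0 (0 : H1 N) v
    rw [zero_smul, zero_mul] at this
    rw [Prod.snd_zero, inner_zero_left]
    exact this.symm
  smul_mem' := by
    rintro c p ⟨hp, h1⟩
    refine ⟨(H1 N).smul_mem c hp, fun v => ?_⟩
    rw [Prod.smul_snd, real_inner_smul_left, h1, ← formA_smul_left]
    rfl

/-- The operator `A_β` (that is, `-Δ + V_β`) in `L²(ℝ^N)`. -/
def opA {N : ℕ} (V : RN N → ℝ) (hm : Measurable V) (hb : ∃ M, ∀ x, |V x| ≤ M) (β : ℝ) :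
    L2 N →ₗ.[ℝ] L2 N :=
  (graphA V hm hb β).toLinearPMap

/-- The graph of `A_Ω`: `u ∈ D(A_Ω)` and `A_Ω u = w` iff `u ∈ H¹_Ω(ℝ^N)`, `w ∈ L²_Ω(ℝ^N)` and
`⟨w, v⟩_{L²} = ⟨u, v⟩_{H¹}` for all `v ∈ H¹_Ω(ℝ^N)`. -/
def graphAΩ {N : ℕ} (Ω : Set (RN N)) : Submodule ℝ (L2Ω Ω × L2Ω Ω) where
  carrier := {p | ∃ hu : (p.1 : L2 N) ∈ H1 N, ∀ v ∈ H1Ω Ω,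
    inner ℝ (p.2 : L2 N) (v : L2 N) = innerH1 ⟨p.1, hu⟩ v}
  add_mem' := by
    rintro p q ⟨hp, h1⟩ ⟨hq, h2⟩
    refine ⟨(H1 N).add_mem hp hq, fun v hv => ?_⟩
    rw [Prod.snd_add, Submodule.coe_add, inner_add_left, h1 v hv, h2 v hv, ← innerH1_add_left]
    rfl
  zero_mem' := by
    refine ⟨(H1 N).zero_mem, fun v hv => ?_⟩
    have := innerH1_smul_left 0 (0 : H1 N) v
    rw [zero_smul, zero_mul] at this
    rw [Prod.snd_zero, Submodule.coe_zero, inner_zero_left]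
    exact this.symm
  smul_mem' := by
    rintro c p ⟨hp, h1⟩
    refine ⟨(H1 N).smul_mem c hp, fun v hv => ?_⟩
    rw [Prod.smul_snd, Submodule.coe_smul, real_inner_smul_left, h1 v hv, ← innerH1_smul_left]
    rfl

/-- The operator `A_Ω` (that is, `-Δ + 1` in `Ω` with Dirichlet boundary condition)
in `L²_Ω(ℝ^N)`. -/
def opAΩ {N : ℕ} (Ω : Set (RN N)) : L2Ω Ω →ₗ.[ℝ] L2Ω Ω :=
  (graphAΩ Ω).toLinearPMap

lemma hasWeakGrad_test {N : ℕ} {φ : RN N → ℝ} (hφ : ContDiff ℝ ∞ φ) (hc : HasCompactSupport φ) :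
    (memLp_test hφ hc).toLp φ ∈ H1 N := by
  have hG : MemLp (gradient φ) 2 (volume : Measure (RN N)) :=
    Continuous.memLp_of_hasCompactSupport
      ((InnerProductSpace.toDual ℝ (RN N)).symm.continuous.comp
        (hφ.continuous_fderiv (by simp)))
      ((hc.fderiv (𝕜 := ℝ)).comp_left (g := (InnerProductSpace.toDual ℝ (RN N)).symm) (map_zero _))
  refine ⟨hG.toLp _, ?_⟩
  intro η hη hcη i
  have hd : ∀ x, gradient φ x i = fderiv ℝ φ x (EuclideanSpace.single i 1) := by
    intro x
    have h1 : inner ℝ (gradient φ x) (EuclideanSpace.single i (1 : ℝ))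
        = fderiv ℝ φ x (EuclideanSpace.single i 1) := by
      exact InnerProductSpace.toDual_symm_apply
    rw [← h1, EuclideanSpace.inner_single_right]
    simp
  have e1 : ∫ x, (memLp_test hφ hc).toLp φ x * fderiv ℝ η x (EuclideanSpace.single i 1)
      = ∫ x, φ x * fderiv ℝ η x (EuclideanSpace.single i 1) := by
    apply integral_congr_ae
    filter_upwards [(memLp_test hφ hc).coeFn_toLp] with x hx
    rw [hx]
  have e2 : ∫ x, hG.toLp _ x i * η x
      = ∫ x, fderiv ℝ φ x (EuclideanSpace.single i 1) * η x := by
    apply integral_congr_ae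
    filter_upwards [hG.coeFn_toLp] with x hx
    rw [hx, hd]
  rw [e1, e2]
  exact integral_mul_fderiv_eq_neg_fderiv_mul_of_integrable
    (integrable_mul (memLp_fderiv_test hφ hc _) (memLp_test hη hcη))
    (integrable_mul (memLp_test hφ hc) (memLp_fderiv_test hη hcη _))
    (integrable_mul (memLp_test hφ hc) (memLp_test hη hcη))
    (fun x _ => hφ.differentiable (by simp) x) (fun x _ => hη.differentiable (by simp) x)

/-- A function in `L²` that is `L²`-orthogonal to `H¹_Ω` vanishes a.e. in `Ω`. -/
lemma ae_zero_of_orthogonal {N : ℕ} {Ω : Set (RN N)} (hΩ : IsOpen Ω) (w : L2 N)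
    (hw : ∀ v ∈ H1Ω Ω, inner ℝ w (v : L2 N) = 0) : ∀ᵐ x, x ∈ Ω → w x = 0 := by
  refine hΩ.ae_eq_zero_of_integral_contDiff_smul_eq_zero
    (((Lp.memLp w).locallyIntegrable (by norm_num)).locallyIntegrableOn Ω) ?_
  intro φ hφ hc hs
  have hmem : (⟨_, hasWeakGrad_test hφ hc⟩ : H1 N) ∈ H1Ω Ω := by
    change ∀ᵐ x, x ∉ Ω → (memLp_test hφ hc).toLp φ x = 0
    filter_upwards [(memLp_test hφ hc).coeFn_toLp] with x hx hxΩ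
    rw [hx]
    exact image_eq_zero_of_notMem_tsupport fun h => hxΩ (hs h)
  have h := hw _ hmem
  rw [L2.inner_def] at h
  rw [← h]
  apply integral_congr_ae
  filter_upwards [(memLp_test hφ hc).coeFn_toLp] with x hx
  simp [hx]

/-- `A_β` is single-valued, so that the graph of `opA` is `graphA`. -/
lemma graphA_functional {N : ℕ} (V : RN N → ℝ) (hm : Measurable V) (hb : ∃ M, ∀ x, |V x| ≤ M)
    (β : ℝ) : ∀ p ∈ graphA V hm hb β, p.1 = 0 → p.2 = 0 := by
  rintro ⟨u, w⟩ ⟨hu, h⟩ (rfl : u = 0)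
  have hz : ∀ v : H1 N, inner ℝ w (v : L2 N) = 0 := by
    intro v
    have := formA_smul_left V β 0 (0 : H1 N) v
    rw [zero_smul, zero_mul] at this
    exact (h v).trans this
  have := ae_zero_of_orthogonal isOpen_univ w (fun v _ => hz v)
  apply Lp.ext
  filter_upwards [this, Lp.coeFn_zero ℝ 2 (volume : Measure (RN N))] with x h1 h2
  rw [h2, h1 (mem_univ x), Pi.zero_apply]

/-- `A_Ω` is single-valued, so that the graph of `opAΩ` is `graphAΩ`. -/
lemma graphAΩ_functional {N : ℕ} {Ω : Set (RN N)} (hΩ : IsOpen Ω) :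
    ∀ p ∈ graphAΩ Ω, p.1 = 0 → p.2 = 0 := by
  rintro ⟨u, w⟩ ⟨hu, h⟩ (rfl : u = 0)
  have hz : ∀ v ∈ H1Ω Ω, inner ℝ (w : L2 N) (v : L2 N) = 0 := by
    intro v hv
    have := innerH1_smul_left 0 (0 : H1 N) v
    rw [zero_smul, zero_mul] at this
    exact (h v hv).trans this
  have h1 := ae_zero_of_orthogonal hΩ (w : L2 N) hz
  have h2 : ∀ᵐ x, x ∉ Ω → (w : L2 N) x = 0 := w.2
  apply Subtype.ext
  apply Lp.ext
  filter_upwards [h1, h2, Lp.coeFn_zero ℝ 2 (volume : Measure (RN N))] with x h1 h2 h3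
  rw [Submodule.coe_zero, h3, Pi.zero_apply]
  by_cases hx : x ∈ Ω
  · exact h1 hx
  · exact h2 hx

/-- The bounded everywhere defined operator `R` is the inverse of the unbounded operator `T`. -/
def IsBoundedInverse {E : Type*} [NormedAddCommGroup E] [NormedSpace ℝ E]
    (T : E →ₗ.[ℝ] E) (R : E →L[ℝ] E) : Prop :=
  (∀ f : E, ∃ h : R f ∈ T.domain, T ⟨R f, h⟩ = f) ∧ ∀ u : T.domain, R (T u) = u

/-- The operator `-A - λ I`, with the domain of `A`. -/
def negSub {E : Type*} [NormedAddCommGroup E] [NormedSpace ℝ E]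
    (A : E →ₗ.[ℝ] E) (lam : ℝ) : E →ₗ.[ℝ] E where
  domain := A.domain
  toFun := -A.toFun - lam • A.domain.subtype

end WellPotential

end

namespace WellPotential

/-! ### Penalised coercive forms in Hilbert spaces -/

section Abstract

open ContinuousLinearMap

variable {E F : Type*} [NormedAddCommGroup E] [InnerProductSpace ℝ E]
  [NormedAddCommGroup F] [InnerProductSpace ℝ F]

/-! The problem is an abstract penalisation. Let `E` be `H¹` with its own inner product, `J` its
contractive embedding into `F = L²`, and `M` multiplication by `V` on `L²`. From `0 ≤ V ≤ 1` comes
`‖M x‖² ≤ ⟨M x, x⟩`. Since `V > 0` a.e. off the closure of `Ω` and the boundary is a null set, the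
kernel of `M J` is exactly `H¹_Ω` (`mul_operator_eq_zero_iff`). The form with shift `λ > -1` is
coercive with constant `c = min 1 (1 + λ)`, independent of `β`, so Lax-Milgram gives existence,
uniqueness and bounded solution operators.

For the convergence (`penalised_tendsto`), put `w_n = u_n - u_Ω` and test the equation for `u_n`
with `w_n`. This gives `c ‖w_n‖²_{1,β_n} ≤ ⟨f_n - f, J w_n⟩ + ⟨a, w_n⟩`, where `a` is the residual
of `u_Ω` in the unpenalised equation on all of `E`. Hence the energies are bounded, and `‖M J w_n‖²
≤ Q / β_n → 0`. The equation for `u_Ω` says that `a` is orthogonal to `ker (M J)`, so `a` lies in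
the closure of the range of `(M J)*`, and therefore `⟨a, w_n⟩ → 0`
(`tendsto_inner_of_mem_ker_orthogonal`). No compactness is used, so the whole sequence converges. -/

lemma perturbed_form_coercive {J : E →L[ℝ] F} (hJ : ∀ u, ‖J u‖ ≤ ‖u‖) {M : F →L[ℝ] F}
    {β lam : ℝ} (u : E) (hM : 0 ≤ β * inner ℝ (M (J u)) (J u)) :
    min 1 (1 + lam) * (inner ℝ u u + β * inner ℝ (M (J u)) (J u))
      ≤ inner ℝ u u + β * inner ℝ (M (J u)) (J u) + lam * inner ℝ (J u) (J u) := by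
  have h1 : ‖J u‖ ^ 2 ≤ ‖u‖ ^ 2 := by gcongr; exact hJ u
  have h0 : 0 ≤ ‖J u‖ ^ 2 := by positivity
  simp only [real_inner_self_eq_norm_sq]
  -- For `λ ≥ 0` the shift term is dropped. For `λ ≤ 0`, `λ ‖J u‖² ≥ λ ‖u‖²` because `J` is a
  -- contraction, and the penalty only loses the factor `1 + λ ≤ 1`.
  rcases le_total 0 lam with h | h
  · rw [min_eq_left (by linarith)]
    nlinarith
  · rw [min_eq_right (by linarith)]
    nlinarith

/-- The Lax-Milgram solution operator of the form
`⟨u, v⟩ + β ⟨M J u, J v⟩ + λ ⟨J u, J v⟩`. -/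
lemma exists_solution_operator [CompleteSpace E] [CompleteSpace F]
    {J : E →L[ℝ] F} (hJ : ∀ u, ‖J u‖ ≤ ‖u‖) {M : F →L[ℝ] F}
    (hM : ∀ x, 0 ≤ inner ℝ (M x) x) {β lam : ℝ} (hβ : 0 ≤ β) (hlam : -1 < lam) :
    ∃ S : F →L[ℝ] E, ∀ f v, inner ℝ (S f) v + β * inner ℝ (M (J (S f))) (J v)
      + lam * inner ℝ (J (S f)) (J v) = inner ℝ f (J v) := by
  -- `T = I + J* (β M + λ) J` represents the form in the inner product of `E`; the solution operator
  -- is then the inverse of `T` composed with `J*`.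
  let T : E →L[ℝ] E :=
    ContinuousLinearMap.id ℝ E + adjoint J ∘L (β • M + lam • ContinuousLinearMap.id ℝ F) ∘L J
  have hT : ∀ u v, inner ℝ (T u) v = inner ℝ u v + β * inner ℝ (M (J u)) (J v)
      + lam * inner ℝ (J u) (J v) := by
    intro u v
    simp [T, inner_add_left, adjoint_inner_left, real_inner_smul_left, add_assoc]
  let B : E →L[ℝ] E →L[ℝ] ℝ := (innerSL ℝ : E →L[ℝ] E →L[ℝ] ℝ) ∘L T
  have hB : IsCoercive B := by
    refine ⟨min 1 (1 + lam), lt_min one_pos (by linarith), fun u => ?_⟩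
    have hb := mul_nonneg hβ (hM (J u))
    have hc : 0 ≤ min 1 (1 + lam) := le_min zero_le_one (by linarith)
    change _ ≤ inner ℝ (T u) u
    rw [hT]
    refine le_trans ?_ (perturbed_form_coercive hJ u hb)
    rw [mul_assoc, ← real_inner_self_eq_norm_mul_norm]
    gcongr
    linarith
  refine ⟨hB.continuousLinearEquivOfBilin.symm.toContinuousLinearMap ∘L adjoint J, fun f v => ?_⟩
  have h := hB.continuousLinearEquivOfBilin_apply
    (hB.continuousLinearEquivOfBilin.symm (adjoint J f)) v
  rw [ContinuousLinearEquiv.apply_symm_apply, adjoint_inner_left] at h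
  rw [h, ← hT]
  rfl

lemma solution_unique {J : E →L[ℝ] F} (hJ : ∀ u, ‖J u‖ ≤ ‖u‖) {M : F →L[ℝ] F}
    (hM : ∀ x, 0 ≤ inner ℝ (M x) x) {β lam : ℝ} (hβ : 0 ≤ β) (hlam : -1 < lam)
    {f : F} {u u' : E}
    (hu : ∀ v, inner ℝ u v + β * inner ℝ (M (J u)) (J v) + lam * inner ℝ (J u) (J v)
      = inner ℝ f (J v))
    (hu' : ∀ v, inner ℝ u' v + β * inner ℝ (M (J u')) (J v) + lam * inner ℝ (J u') (J v)
      = inner ℝ f (J v)) : u = u' := by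
  have hb := mul_nonneg hβ (hM (J (u - u')))
  have hc := perturbed_form_coercive hJ (lam := lam) (u - u') hb
  have h0 : inner ℝ (u - u') (u - u') + β * inner ℝ (M (J (u - u'))) (J (u - u'))
      + lam * inner ℝ (J (u - u')) (J (u - u')) = 0 := by
    have h1 := hu (u - u')
    have h2 := hu' (u - u')
    have e (w : E) : inner ℝ (u - u') w + β * inner ℝ (M (J (u - u'))) (J w)
        + lam * inner ℝ (J (u - u')) (J w)
        = (inner ℝ u w + β * inner ℝ (M (J u)) (J w) + lam * inner ℝ (J u) (J w))
          - (inner ℝ u' w + β * inner ℝ (M (J u')) (J w) + lam * inner ℝ (J u') (J w)) := by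
      simp only [map_sub, inner_sub_left]
      ring
    rw [e, h1, h2, sub_self]
  rw [h0] at hc
  have hm : 0 < min 1 (1 + lam) := lt_min one_pos (by linarith)
  have h1 := nonpos_of_mul_nonpos_right hc hm
  have h2 : inner ℝ (u - u') (u - u') ≤ (0 : ℝ) := by linarith
  exact sub_eq_zero.1 (inner_self_eq_zero.1 (h2.antisymm real_inner_self_nonneg))

/-- The solution operator of the form `⟨u, v⟩ + λ ⟨J u, J v⟩` on a closed subspace. -/
lemma exists_solution_operator_on [CompleteSpace F] {J : E →L[ℝ] F} (hJ : ∀ u, ‖J u‖ ≤ ‖u‖)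
    (K : Submodule ℝ E) [CompleteSpace K] {lam : ℝ} (hlam : -1 < lam) :
    ∃ S : F →L[ℝ] E, ∀ f, S f ∈ K ∧
      ∀ v ∈ K, inner ℝ (S f) v + lam * inner ℝ (J (S f)) (J v) = inner ℝ f (J v) := by
  -- The constrained problem is the case without penalty, with `K` in place of `E`.
  obtain ⟨S, hS⟩ := exists_solution_operator (E := K) (J := J ∘L K.subtypeL) (M := 0) (β := 0)
    (fun u => hJ u) (by simp) le_rfl hlam
  refine ⟨K.subtypeL ∘L S, fun f => ⟨(S f).2, fun v hv => ?_⟩⟩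
  simpa using hS f ⟨v, hv⟩

lemma solution_unique_on {J : E →L[ℝ] F} (hJ : ∀ u, ‖J u‖ ≤ ‖u‖) {K : Submodule ℝ E}
    {lam : ℝ} (hlam : -1 < lam) {f : F} {u u' : E} (huK : u ∈ K) (huK' : u' ∈ K)
    (hu : ∀ v ∈ K, inner ℝ u v + lam * inner ℝ (J u) (J v) = inner ℝ f (J v))
    (hu' : ∀ v ∈ K, inner ℝ u' v + lam * inner ℝ (J u') (J v) = inner ℝ f (J v)) : u = u' := by
  have h := solution_unique (E := K) (J := J ∘L K.subtypeL) (M := 0) (β := 0) (f := f)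
    (u := ⟨u, huK⟩) (u' := ⟨u', huK'⟩) (fun u => hJ u) (by simp) le_rfl hlam
    (fun v => by simpa using hu v v.2) (fun v => by simpa using hu' v v.2)
  exact congrArg Subtype.val h

/-- If `T w → 0` along a bounded family `w`, then every vector orthogonal to `ker T` tests `w` to
zero in the limit. -/
lemma tendsto_inner_of_mem_ker_orthogonal [CompleteSpace E] [CompleteSpace F]
    {ι : Type*} {l : Filter ι} {T : E →L[ℝ] F} {w : ι → E}
    {C : ℝ} (hw : ∀ i, ‖w i‖ ≤ C) (hT : Tendsto (fun i => T (w i)) l (𝓝 0))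
    {a : E} (ha : a ∈ (T : E →ₗ[ℝ] F).kerᗮ) : Tendsto (fun i => inner ℝ a (w i)) l (𝓝 (0 : ℝ)) := by
  -- `(ker T)ᗮ` is the closure of the range of `T*`. For `b = T* y` near `a`, `⟨b, w⟩ = ⟨y, T w⟩ →
  -- 0`, and the bound on `w` controls the error.
  rw [orthogonal_ker, ← SetLike.mem_coe, Submodule.topologicalClosure_coe,
    Metric.mem_closure_iff] at ha
  rw [Metric.tendsto_nhds]
  intro ε hε
  obtain ⟨b, ⟨y, rfl⟩, hb⟩ := ha (ε / (2 * (|C| + 1))) (by positivity)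
  have h1 : Tendsto (fun i => inner ℝ y (T (w i))) l (𝓝 (0 : ℝ)) := by
    simpa using (tendsto_const_nhds (x := y)).inner (𝕜 := ℝ) hT
  filter_upwards [Metric.tendsto_nhds.1 h1 (ε / 2) (by positivity)] with i hi
  rw [dist_zero_right] at hi ⊢
  have e : inner ℝ a (w i) = inner ℝ (a - adjoint T y) (w i) + inner ℝ y (T (w i)) := by
    rw [inner_sub_left, adjoint_inner_left]; ring
  have h2 : ‖inner ℝ (a - adjoint T y) (w i)‖ ≤ ε / 2 := by
    refine (norm_inner_le_norm _ _).trans ?_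
    rw [← dist_eq_norm]
    calc _ ≤ (ε / (2 * (|C| + 1))) * (|C| + 1) := by
          gcongr
          · exact hb.le
          · exact ((hw i).trans (le_abs_self C)).trans (by linarith)
      _ = ε / 2 := by field_simp
  rw [e]
  exact (norm_add_le _ _).trans_lt (by linarith)

/-- As `β → ∞` the solutions of the penalised problems converge, in the energy norms, to the
solution of the problem constrained to the kernel of the penalty. -/
lemma penalised_tendsto [CompleteSpace E] [CompleteSpace F]
    {J : E →L[ℝ] F} (hJ : ∀ u, ‖J u‖ ≤ ‖u‖) {M : F →L[ℝ] F}
    (hM : ∀ x, ‖M x‖ ^ 2 ≤ inner ℝ (M x) x) {β : ℕ → ℝ} (hβ : ∀ n, 0 < β n)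
    (hβ_lim : Tendsto β atTop atTop) {lam : ℝ} (hlam : -1 < lam)
    {f : ℕ → F} {f₀ : F} (hf : Tendsto f atTop (𝓝 f₀)) {u : ℕ → E} {u₀ : E}
    (hu : ∀ n v, inner ℝ (u n) v + β n * inner ℝ (M (J (u n))) (J v)
      + lam * inner ℝ (J (u n)) (J v) = inner ℝ (f n) (J v))
    (hu₀ : M (J u₀) = 0)
    (hs₀ : ∀ v, M (J v) = 0 → inner ℝ u₀ v + lam * inner ℝ (J u₀) (J v) = inner ℝ f₀ (J v)) :
    Tendsto (fun n => inner ℝ (u n - u₀) (u n - u₀)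
      + β n * inner ℝ (M (J (u n - u₀))) (J (u n - u₀))) atTop (𝓝 0) := by
  set w : ℕ → E := fun n => u n - u₀ with hw
  set q : ℕ → ℝ := fun n => inner ℝ (w n) (w n) + β n * inner ℝ (M (J (w n))) (J (w n)) with hq
  set c := min 1 (1 + lam)
  have hc : 0 < c := lt_min one_pos (by linarith)
  -- The residual of `u₀`: it vanishes on `ker (M J)` by `hs₀`, but not on all of `E` in general.
  set a : E := adjoint J f₀ - u₀ - lam • adjoint J (J u₀) with ha
  have hM0 : ∀ x, 0 ≤ inner ℝ (M x) x := fun x => (sq_nonneg _).trans (hM x)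
  have hpos : ∀ n, 0 ≤ β n * inner ℝ (M (J (w n))) (J (w n)) :=
    fun n => mul_nonneg (hβ n).le (hM0 _)
  have ha_apply : ∀ v, inner ℝ a v = inner ℝ f₀ (J v) - inner ℝ u₀ v
      - lam * inner ℝ (J u₀) (J v) := fun v => by
    simp [ha, inner_sub_left, adjoint_inner_left, real_inner_smul_left]
  have ha_mem : a ∈ ((M ∘L J : E →L[ℝ] F) : E →ₗ[ℝ] F).kerᗮ := by
    rw [Submodule.mem_orthogonal']
    intro v hv
    rw [ha_apply, ← hs₀ v hv]; ring
  -- Coercivity at `w n`, followed by the equation for `u n` tested with `w n`. The penalty does not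
  -- see `u₀`, since `M (J u₀) = 0`.
  have key : ∀ n, c * q n ≤ inner ℝ (f n - f₀) (J (w n)) + inner ℝ a (w n) := by
    intro n
    refine (perturbed_form_coercive hJ (w n) (hpos n)).trans_eq ?_
    have h := hu n (w n)
    have e1 : M (J (w n)) = M (J (u n)) := by simp [hw, hu₀]
    have e2 : J (w n) = J (u n) - J u₀ := by simp [hw]
    have e3 : inner ℝ (w n) (w n) = inner ℝ (u n) (w n) - inner ℝ u₀ (w n) := by
      rw [← inner_sub_left]
    have e4 : inner ℝ (J (w n)) (J (w n))
        = inner ℝ (J (u n)) (J (w n)) - inner ℝ (J u₀) (J (w n)) := by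
      rw [← inner_sub_left, ← e2]
    rw [e3, e4, e1, ha_apply, inner_sub_left, ← h]; ring
  obtain ⟨D, hD⟩ : ∃ D, ∀ n, ‖f n - f₀‖ ≤ D := by
    obtain ⟨D, hD⟩ := (hf.sub_const f₀).norm.bddAbove_range
    exact ⟨D, fun n => hD ⟨n, rfl⟩⟩
  have hwq : ∀ n, ‖w n‖ ^ 2 ≤ q n := fun n => by
    simp only [hq, real_inner_self_eq_norm_sq]; linarith [hpos n]
  have hbound : ∀ n, c * q n ≤ (D + ‖a‖) * ‖w n‖ := by
    intro n
    refine (key n).trans ?_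
    rw [add_mul]
    refine add_le_add ((real_inner_le_norm _ _).trans ?_) (real_inner_le_norm _ _)
    exact mul_le_mul (hD n) (hJ _) (norm_nonneg _) ((norm_nonneg _).trans (hD n))
  have hD0 : 0 ≤ D := (norm_nonneg _).trans (hD 0)
  -- From `c ‖w n‖² ≤ c q n ≤ (D + ‖a‖) ‖w n‖`, dividing by `‖w n‖` when it is nonzero.
  have hwb : ∀ n, ‖w n‖ ≤ (D + ‖a‖) / c := by
    intro n
    rcases (norm_nonneg (w n)).eq_or_lt with h | h
    · rw [← h]; positivity
    · rw [le_div_iff₀ hc]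
      have h1 : c * ‖w n‖ ^ 2 ≤ (D + ‖a‖) * ‖w n‖ :=
        (mul_le_mul_of_nonneg_left (hwq n) hc.le).trans (hbound n)
      refine le_of_mul_le_mul_right ?_ h
      linarith
  obtain ⟨Q, hQ⟩ : ∃ Q, ∀ n, q n ≤ Q := by
    refine ⟨(D + ‖a‖) * ((D + ‖a‖) / c) / c, fun n => ?_⟩
    rw [le_div_iff₀ hc, mul_comm]
    exact (hbound n).trans (by gcongr; exact hwb n)
  -- `β n ‖M J w‖² ≤ β n ⟨M J w, J w⟩ ≤ q n ≤ Q`.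
  have hT : Tendsto (fun n => (M ∘L J) (w n)) atTop (𝓝 0) := by
    rw [tendsto_zero_iff_norm_tendsto_zero]
    have h1 : Tendsto (fun n => ‖(M ∘L J) (w n)‖ ^ 2) atTop (𝓝 0) := by
      refine squeeze_zero (fun n => sq_nonneg _) (fun n => ?_)
        (hβ_lim.const_div_atTop Q)
      rw [le_div_iff₀ (hβ n), mul_comm]
      refine (mul_le_mul_of_nonneg_left (hM (J (w n))) (hβ n).le).trans ((hQ n).trans' ?_)
      have : 0 ≤ inner ℝ (w n) (w n) := real_inner_self_nonneg
      simp only [hq]; linarith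
    simpa using h1.sqrt
  have hlim : Tendsto (fun n => c⁻¹ * (inner ℝ (f n - f₀) (J (w n)) + inner ℝ a (w n)))
      atTop (𝓝 0) := by
    have h1 := tendsto_inner_of_mem_ker_orthogonal hwb hT ha_mem
    have h2 : Tendsto (fun n => inner ℝ (f n - f₀) (J (w n))) atTop (𝓝 (0 : ℝ)) := by
      refine squeeze_zero_norm (a := fun n => ‖f n - f₀‖ * ((D + ‖a‖) / c)) (fun n => ?_) ?_
      · refine (norm_inner_le_norm _ _).trans ?_
        gcongr
        exact (hJ _).trans (hwb n)
      · have := (hf.sub_const f₀).norm.mul_const ((D + ‖a‖) / c)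
        simpa using this
    simpa using (h2.add h1).const_mul c⁻¹
  refine squeeze_zero (fun n => (sq_nonneg _).trans (hwq n)) (fun n => ?_) hlim
  rw [inv_mul_eq_div, le_div_iff₀ hc, mul_comm]
  exact key n

end Abstract

/-! ### Null sets -/

/-- Each chart flattens the boundary into a coordinate hyperplane, a proper subspace and hence null;
the differentiable inverse chart maps null sets to null sets. -/
lemma HasC2Boundary.volume_frontier {N : ℕ} {Ω : Set (RN N)} (h : HasC2Boundary Ω) :
    volume (frontier Ω) = 0 := by
  refine measure_null_of_locally_null _ fun x₀ hx₀ => ?_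
  obtain ⟨ψ, i, hs, -, hd, hψ⟩ := h x₀ hx₀
  refine ⟨ψ.source ∩ frontier Ω,
    inter_mem (mem_nhdsWithin_of_mem_nhds (ψ.open_source.mem_nhds hs)) self_mem_nhdsWithin, ?_⟩
  have hplane : volume {y : RN N | y i = 0} = 0 := by
    have := Measure.addHaar_submodule (volume : Measure (RN N))
      (LinearMap.ker (EuclideanSpace.proj i : RN N →L[ℝ] ℝ).toLinearMap) ?_
    · exact this
    · intro ht
      have : EuclideanSpace.single i (1 : ℝ)
          ∈ LinearMap.ker (EuclideanSpace.proj i : RN N →L[ℝ] ℝ).toLinearMap := ht ▸ trivial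
      simp at this
  have himg : volume (ψ.symm '' (ψ.target ∩ {y | y i = 0})) = 0 :=
    addHaar_image_eq_zero_of_differentiableOn_of_addHaar_eq_zero _
      ((hd.differentiableOn (by norm_num)).mono inter_subset_left)
      (measure_mono_null inter_subset_right hplane)
  refine measure_mono_null ?_ himg
  rintro x ⟨hx, hxf⟩
  exact ⟨ψ x, ⟨ψ.map_source hx, ((hψ x hx).2).1 hxf⟩, ψ.left_inv hx⟩

/-- Every point off the closure has a closed ball on which `V` is a.e. at least its positive
essential infimum; a locally null set is null. -/
lemma IsWellPotential.ae_pos {N : ℕ} {Ω : Set (RN N)} {V : RN N → ℝ} (hV : IsWellPotential Ω V)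
    (hb : ∃ M, ∀ x, |V x| ≤ M) : ∀ᵐ x, x ∉ closure Ω → 0 < V x := by
  obtain ⟨M, hM⟩ := hb
  have : volume {x | x ∉ closure Ω ∧ V x ≤ 0} = 0 := by
    refine measure_null_of_locally_null _ fun x₀ hx₀ => ?_
    obtain ⟨r, hr, hsub⟩ := Metric.nhds_basis_closedBall.mem_iff.1
      (isClosed_closure.isOpen_compl.mem_nhds (show x₀ ∈ (closure Ω)ᶜ from hx₀.1))
    have hpos := hV.essInf_pos x₀ r hr hsub
    refine ⟨Metric.closedBall x₀ r ∩ {x | x ∉ closure Ω ∧ V x ≤ 0},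
      inter_mem (mem_nhdsWithin_of_mem_nhds (Metric.closedBall_mem_nhds _ hr))
        self_mem_nhdsWithin, ?_⟩
    -- The lower bound `-M` makes the essential infimum a genuine a.e. lower bound.
    have h := ae_essInf_le (f := V) (μ := volume.restrict (Metric.closedBall x₀ r))
      (isBoundedUnder_of ⟨-M, fun x => (abs_le.1 (hM x)).1⟩)
    rw [ae_restrict_iff' Metric.isClosed_closedBall.measurableSet] at h
    rw [measure_eq_zero_iff_ae_notMem]
    filter_upwards [h] with x hx hx'
    exact absurd (hpos.trans_le (hx hx'.1)) (not_lt.2 hx'.2.2)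
  rw [measure_eq_zero_iff_ae_notMem] at this
  filter_upwards [this] with x hx hxΩ
  by_contra hc
  exact hx ⟨hxΩ, not_lt.1 hc⟩

/-! ### Multiplication by the potential -/

lemma memLp_mul_of_bounded {N : ℕ} {V : RN N → ℝ} (hm : Measurable V)
    {C : ℝ} (hb : ∀ x, |V x| ≤ C) (u : L2 N) : MemLp (fun x => V x * u x) 2 volume := by
  refine (Lp.memLp u).of_le_mul (c := C)
    (hm.aestronglyMeasurable.mul (Lp.aestronglyMeasurable u)) (ae_of_all _ fun x => ?_)
  rw [norm_mul, Real.norm_eq_abs]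
  gcongr
  exact hb x

/-- Multiplication by a bounded function, as an operator in `L²`. -/
lemma exists_mul_operator {N : ℕ} {V : RN N → ℝ} (hm : Measurable V) (hb : ∃ C, ∀ x, |V x| ≤ C) :
    ∃ M : L2 N →L[ℝ] L2 N, ∀ u : L2 N, ∀ᵐ x, M u x = V x * u x := by
  obtain ⟨C, hC⟩ := hb
  have h := memLp_mul_of_bounded hm hC
  let L : L2 N →ₗ[ℝ] L2 N :=
    { toFun := fun u => (h u).toLp _
      map_add' := fun u v => by
        apply Lp.ext
        filter_upwards [(h (u + v)).coeFn_toLp, (h u).coeFn_toLp, (h v).coeFn_toLp,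
          Lp.coeFn_add u v, Lp.coeFn_add ((h u).toLp _) ((h v).toLp _)] with x h1 h2 h3 h4 h5
        rw [h1, h5, Pi.add_apply, h2, h3, h4, Pi.add_apply, mul_add]
      map_smul' := fun c u => by
        apply Lp.ext
        filter_upwards [(h (c • u)).coeFn_toLp, (h u).coeFn_toLp,
          Lp.coeFn_smul c u, Lp.coeFn_smul c ((h u).toLp _)] with x h1 h2 h3 h4
        rw [h1, RingHom.id_apply, h4, Pi.smul_apply, h2, h3, Pi.smul_apply, smul_eq_mul,
          smul_eq_mul]
        ring }
  refine ⟨L.mkContinuous C fun u => ?_, fun u => (h u).coeFn_toLp⟩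
  refine Lp.norm_le_mul_norm_of_ae_le_mul ?_
  filter_upwards [(h u).coeFn_toLp] with x hx
  change ‖(h u).toLp _ x‖ ≤ _
  rw [hx, norm_mul, Real.norm_eq_abs]
  gcongr
  exact hC x

section MulOperator

variable {N : ℕ} {V : RN N → ℝ} {M : L2 N →L[ℝ] L2 N}

lemma inner_mul_operator
    (hM : ∀ u : L2 N, ∀ᵐ x, M u x = V x * u x) (u v : L2 N) : inner ℝ (M u) v = ∫ x, V x * u x * v x := by
  rw [L2.inner_def]
  apply integral_congr_ae
  filter_upwards [hM u] with x hx
  rw [hx]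
  simp [mul_comm]

/-- Pointwise `V² u² ≤ V u²`, as `0 ≤ V ≤ 1`. Thus the penalty energy controls the norm of `M u`. -/
lemma norm_sq_mul_operator_le
    (hM : ∀ u : L2 N, ∀ᵐ x, M u x = V x * u x) {Ω : Set (RN N)} (hV : IsWellPotential Ω V) (u : L2 N) :
    ‖M u‖ ^ 2 ≤ inner ℝ (M u) u := by
  rw [← real_inner_self_eq_norm_sq, L2.inner_def, L2.inner_def]
  refine integral_mono_ae (L2.integrable_inner _ _) (L2.integrable_inner _ _) ?_
  filter_upwards [hM u, hV.bounds] with x hx hb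
  rw [hx]
  simp only [RCLike.inner_apply, conj_trivial]
  nlinarith [mul_nonneg (mul_nonneg hb.1 (sub_nonneg.2 hb.2)) (sq_nonneg (u x))]

/-- Where `V > 0`, `V u = 0` forces `u = 0`. This gives vanishing off the closure of `Ω` only; the
null boundary closes the gap to `Ω` itself. -/
lemma mul_operator_eq_zero_iff
    (hM : ∀ u : L2 N, ∀ᵐ x, M u x = V x * u x) {Ω : Set (RN N)} (hΩ : HasC2Boundary Ω) (hV : IsWellPotential Ω V)
    (hb : ∃ M, ∀ x, |V x| ≤ M) (u : L2 N) : M u = 0 ↔ u ∈ L2Ω Ω := by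
  have hfr := measure_eq_zero_iff_ae_notMem.1 hΩ.volume_frontier
  rw [Lp.eq_zero_iff_ae_eq_zero]
  change _ ↔ ∀ᵐ x, x ∉ Ω → u x = 0
  constructor <;> intro h
  · filter_upwards [h, hM u, hV.ae_pos hb, hfr] with x h1 h2 h3 h4 hx
    rw [h2] at h1
    have hx' : x ∉ closure Ω := by
      rw [closure_eq_self_union_frontier]
      exact fun h => h.elim hx h4
    exact (mul_eq_zero.1 h1).resolve_left (h3 hx').ne'
  · filter_upwards [h, hM u, hV.zero_on] with x h1 h2 h3
    rw [h2, Pi.zero_apply]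
    by_cases hx : x ∈ Ω
    · rw [h3 (subset_closure hx), zero_mul]
    · rw [h1 hx, mul_zero]

end MulOperator

/-! ### `H¹` as a Hilbert space -/

/-- The graph of the weak gradient. -/
def gradGraph (N : ℕ) : Submodule ℝ (WithLp 2 (L2 N × L2Vec N)) where
  carrier := {p | HasWeakGrad p.fst p.snd}
  add_mem' := fun h h' => HasWeakGrad.add h h'
  zero_mem' := HasWeakGrad.zero
  smul_mem' := fun c _ h => HasWeakGrad.smul c h

/-- Both sides of each test identity are inner products with fixed `L²` elements, hence continuous.
The graph carries the `H¹` norm, for which it is complete, whereas `H1 N` inherits only the `L²`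
norm. -/
lemma isClosed_gradGraph (N : ℕ) : IsClosed (gradGraph N : Set (WithLp 2 (L2 N × L2Vec N))) := by
  have : (gradGraph N : Set (WithLp 2 (L2 N × L2Vec N))) =
      ⋂ (φ : RN N → ℝ) (_ : ContDiff ℝ ∞ φ) (_ : HasCompactSupport φ) (i : Fin N),
        {p | ∫ x, p.fst x * fderiv ℝ φ x (EuclideanSpace.single i 1)
          = - ∫ x, p.snd x i * φ x} := by
    ext p
    simp only [mem_iInter]
    rfl
  rw [this]
  refine isClosed_iInter fun φ => isClosed_iInter fun hφ => isClosed_iInter fun hc =>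
    isClosed_iInter fun i => ?_
  have hvec : MemLp (fun x => EuclideanSpace.single i (φ x)) 2 (volume : Measure (RN N)) := by
    refine (memLp_test hφ hc).of_le ?_ (ae_of_all _ fun x => by simp)
    have : (fun x => EuclideanSpace.single i (φ x))
        = fun x => φ x • (EuclideanSpace.single i (1 : ℝ) : RN N) := by
      ext x j; simp
    rw [this]
    exact (hφ.continuous.smul continuous_const).aestronglyMeasurable
  have e1 : ∀ u : L2 N, ∫ x, u x * fderiv ℝ φ x (EuclideanSpace.single i 1)
      = inner ℝ u ((memLp_fderiv_test hφ hc (EuclideanSpace.single i 1)).toLp _) := by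
    intro u
    rw [L2.inner_def]
    apply integral_congr_ae
    filter_upwards [(memLp_fderiv_test hφ hc (EuclideanSpace.single i 1)).coeFn_toLp] with x hx
    rw [hx]
    simp [mul_comm]
  have e2 : ∀ g : L2Vec N, ∫ x, g x i * φ x = inner ℝ g (hvec.toLp _) := by
    intro g
    rw [L2.inner_def]
    apply integral_congr_ae
    filter_upwards [hvec.coeFn_toLp] with x hx
    rw [hx, EuclideanSpace.inner_single_right]
    simp [mul_comm]
  simp only [e1, e2]
  exact isClosed_eq
    (((WithLp.fstL 2 ℝ (L2 N) (L2Vec N)).continuous).inner continuous_const)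
    (((WithLp.sndL 2 ℝ (L2 N) (L2Vec N)).continuous).inner continuous_const).neg

instance (N : ℕ) : CompleteSpace (gradGraph N) := (isClosed_gradGraph N).completeSpace_coe

/-- The identification of the graph of the weak gradient with `H¹`. -/
noncomputable def gradGraphEquiv (N : ℕ) : gradGraph N ≃ H1 N where
  toFun p := ⟨p.1.fst, p.1.snd, p.2⟩
  invFun u := ⟨WithLp.toLp 2 ((u : L2 N), weakGrad u), weakGrad_spec u⟩
  left_inv p := by
    have h := (weakGrad_spec ⟨p.1.fst, p.1.snd, p.2⟩).unique p.2
    apply Subtype.ext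
    apply WithLp.ofLp_injective
    exact Prod.ext rfl h
  right_inv u := rfl

lemma weakGrad_gradGraphEquiv {N : ℕ} (p : gradGraph N) :
    weakGrad (gradGraphEquiv N p) = p.1.snd :=
  (weakGrad_spec (gradGraphEquiv N p)).unique p.2

/-- The embedding of `H¹` into `L²`. -/
noncomputable def embL2 (N : ℕ) : gradGraph N →L[ℝ] L2 N :=
  WithLp.fstL 2 ℝ (L2 N) (L2Vec N) ∘L (gradGraph N).subtypeL

lemma coe_gradGraphEquiv {N : ℕ} (p : gradGraph N) :
    (gradGraphEquiv N p : L2 N) = embL2 N p := rfl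

lemma norm_embL2_le {N : ℕ} (p : gradGraph N) : ‖embL2 N p‖ ≤ ‖p‖ :=
  WithLp.norm_fst_le _ p.1

lemma inner_eq_integral {N : ℕ} (u v : L2 N) : inner ℝ u v = ∫ x, u x * v x := by
  rw [L2.inner_def]
  simp [mul_comm]

/-- Translates the energy form into the abstract penalised form. -/
lemma formA_gradGraphEquiv {N : ℕ} {V : RN N → ℝ} (hm : Measurable V)
    (hb : ∃ C, ∀ x, |V x| ≤ C) {M : L2 N →L[ℝ] L2 N}
    (hM : ∀ u : L2 N, ∀ᵐ x, M u x = V x * u x) (β : ℝ) (p q : gradGraph N) :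
    formA V β (gradGraphEquiv N p) (gradGraphEquiv N q)
      = inner ℝ p q + β * inner ℝ (M (embL2 N p)) (embL2 N q) := by
  have h : ∀ u v : L2 N, ∫ x, Vβ V β x * u x * v x = inner ℝ u v + β * inner ℝ (M u) v := by
    intro u v
    obtain ⟨C, hC⟩ := hb
    rw [inner_mul_operator hM, inner_eq_integral, ← integral_const_mul, ← integral_add
      (integrable_mul (Lp.memLp u) (Lp.memLp v))
      ((integrable_mul (memLp_mul_of_bounded hm hC u) (Lp.memLp v)).const_mul β)]
    congr 1
    ext x
    simp only [Vβ]
    ring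
  rw [formA, h, integral_inner_eq, weakGrad_gradGraphEquiv, weakGrad_gradGraphEquiv]
  change _ = inner ℝ p.1.fst q.1.fst + inner ℝ p.1.snd q.1.snd + _
  rw [coe_gradGraphEquiv, coe_gradGraphEquiv]
  change _ + (inner ℝ p.1.fst q.1.fst + _) = _
  ring

lemma innerH1_gradGraphEquiv {N : ℕ} (p q : gradGraph N) :
    innerH1 (gradGraphEquiv N p) (gradGraphEquiv N q) = inner ℝ p q := by
  rw [innerH1, integral_inner_eq, weakGrad_gradGraphEquiv, weakGrad_gradGraphEquiv,
    ← inner_eq_integral, add_comm]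
  rfl

/-! ### The weak solutions and the resolvents -/

section Resolvent

variable {N : ℕ} {Ω : Set (RN N)} {V : RN N → ℝ} {M : L2 N →L[ℝ] L2 N} {β lam : ℝ}

lemma isWeakSol_gradGraphEquiv_iff (hm : Measurable V) (hb : ∃ C, ∀ x, |V x| ≤ C)
    (hM : ∀ u : L2 N, ∀ᵐ x, M u x = V x * u x) {f : L2 N} {p : gradGraph N} :
    IsWeakSol V β lam f (gradGraphEquiv N p) ↔
      ∀ q, inner ℝ p q + β * inner ℝ (M (embL2 N p)) (embL2 N q)
        + lam * inner ℝ (embL2 N p) (embL2 N q) = inner ℝ f (embL2 N q) := by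
  rw [IsWeakSol, ← (gradGraphEquiv N).forall_congr_right]
  simp only [formA_gradGraphEquiv hm hb hM, ← inner_eq_integral,
    coe_gradGraphEquiv]

lemma mem_H1Ω_iff {p : gradGraph N} : gradGraphEquiv N p ∈ H1Ω Ω ↔ embL2 N p ∈ L2Ω Ω := Iff.rfl

lemma isWeakSolΩ_gradGraphEquiv_iff {f : L2 N} {p : gradGraph N} :
    IsWeakSolΩ Ω lam f (gradGraphEquiv N p) ↔ embL2 N p ∈ L2Ω Ω ∧
      ∀ q, embL2 N q ∈ L2Ω Ω → inner ℝ p q + lam * inner ℝ (embL2 N p) (embL2 N q)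
        = inner ℝ f (embL2 N q) := by
  rw [IsWeakSolΩ, mem_H1Ω_iff, ← (gradGraphEquiv N).forall_congr_right]
  simp only [innerH1_gradGraphEquiv, ← inner_eq_integral,
    coe_gradGraphEquiv, mem_H1Ω_iff]

lemma inner_mul_operator_nonneg (hM : ∀ u : L2 N, ∀ᵐ x, M u x = V x * u x)
    (hV : IsWellPotential Ω V) (u : L2 N) : 0 ≤ inner ℝ (M u) u :=
  (sq_nonneg _).trans (norm_sq_mul_operator_le hM hV u)

lemma IsWeakSol.unique (hm : Measurable V) (hb : ∃ C, ∀ x, |V x| ≤ C) (hV : IsWellPotential Ω V)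
    (hβ : 0 ≤ β) (hlam : -1 < lam) {f : L2 N} {u v : H1 N}
    (hu : IsWeakSol V β lam f u) (hv : IsWeakSol V β lam f v) : u = v := by
  obtain ⟨M, hM⟩ := exists_mul_operator hm hb
  obtain ⟨p, rfl⟩ := (gradGraphEquiv N).surjective u
  obtain ⟨q, rfl⟩ := (gradGraphEquiv N).surjective v
  rw [isWeakSol_gradGraphEquiv_iff hm hb hM] at hu hv
  rw [solution_unique norm_embL2_le (inner_mul_operator_nonneg hM hV) hβ hlam hu hv]

/-- The solution operator of `A_β u + λ u = f`. -/
lemma exists_isWeakSol_operator (hm : Measurable V) (hb : ∃ C, ∀ x, |V x| ≤ C)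
    (hV : IsWellPotential Ω V) (hβ : 0 ≤ β) (hlam : -1 < lam) :
    ∃ S : L2 N →L[ℝ] L2 N, ∀ f, ∃ h : S f ∈ H1 N, IsWeakSol V β lam f ⟨S f, h⟩ := by
  obtain ⟨M, hM⟩ := exists_mul_operator hm hb
  obtain ⟨S, hS⟩ := exists_solution_operator norm_embL2_le (inner_mul_operator_nonneg hM hV) hβ hlam
  refine ⟨embL2 N ∘L S, fun f => ⟨(gradGraphEquiv N (S f)).2, ?_⟩⟩
  exact (isWeakSol_gradGraphEquiv_iff hm hb hM).2 (hS f)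

/-- The graph of the weak gradient over `H¹_Ω`. -/
noncomputable def gradGraphΩ (Ω : Set (RN N)) : Submodule ℝ (gradGraph N) :=
  (L2Ω Ω).comap (embL2 N : gradGraph N →ₗ[ℝ] L2 N)

lemma IsWeakSolΩ.unique (hlam : -1 < lam) {f : L2 N} {u v : H1 N}
    (hu : IsWeakSolΩ Ω lam f u) (hv : IsWeakSolΩ Ω lam f v) : u = v := by
  obtain ⟨p, rfl⟩ := (gradGraphEquiv N).surjective u
  obtain ⟨q, rfl⟩ := (gradGraphEquiv N).surjective v
  rw [isWeakSolΩ_gradGraphEquiv_iff] at hu hv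
  rw [solution_unique_on (K := gradGraphΩ Ω) norm_embL2_le hlam hu.1 hv.1 hu.2 hv.2]

/-- It is the kernel of the bounded multiplication by `V`. Closedness supplies the completeness that
Lax-Milgram needs on `H¹_Ω`. -/
lemma isClosed_L2Ω (hm : Measurable V) (hb : ∃ C, ∀ x, |V x| ≤ C)
    (hΩ : HasC2Boundary Ω) (hV : IsWellPotential Ω V) : IsClosed (L2Ω Ω : Set (L2 N)) := by
  obtain ⟨M, hM⟩ := exists_mul_operator hm hb
  have : (L2Ω Ω : Set (L2 N)) = M ⁻¹' {0} := by
    ext u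
    exact (mul_operator_eq_zero_iff hM hΩ hV hb u).symm
  rw [this]
  exact isClosed_singleton.preimage M.continuous

/-- The solution operator of `A_Ω u + λ u = f`. -/
lemma exists_isWeakSolΩ_operator (hcl : IsClosed (L2Ω Ω : Set (L2 N))) (hlam : -1 < lam) :
    ∃ S : L2 N →L[ℝ] L2Ω Ω, ∀ f, ∃ h : (S f : L2 N) ∈ H1 N, IsWeakSolΩ Ω lam f ⟨S f, h⟩ := by
  have : CompleteSpace (gradGraphΩ Ω) :=
    (hcl.preimage (embL2 N).continuous).completeSpace_coe
  obtain ⟨S, hS⟩ := exists_solution_operator_on norm_embL2_le (gradGraphΩ Ω) hlam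
  refine ⟨(embL2 N ∘L S).codRestrict (L2Ω Ω) fun f => (hS f).1,
    fun f => ⟨(gradGraphEquiv N (S f)).2, ?_⟩⟩
  exact isWeakSolΩ_gradGraphEquiv_iff.2 (hS f)

/-- Convergence of the weak solutions in the energy norms. -/
lemma tendsto_normβ_sub (hm : Measurable V) (hb : ∃ C, ∀ x, |V x| ≤ C)
    (hΩ : HasC2Boundary Ω) (hV : IsWellPotential Ω V) {β : ℕ → ℝ} (hβ : ∀ n, 0 < β n)
    (hβ_lim : Tendsto β atTop atTop) (hlam : -1 < lam) {f : ℕ → L2 N} {f₀ : L2 N}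
    (hf : Tendsto f atTop (𝓝 f₀)) {u : ℕ → H1 N} {u₀ : H1 N}
    (hu : ∀ n, IsWeakSol V (β n) lam (f n) (u n)) (hu₀ : IsWeakSolΩ Ω lam f₀ u₀) :
    Tendsto (fun n => normβ V (β n) (u n - u₀)) atTop (𝓝 0) := by
  obtain ⟨M, hM⟩ := exists_mul_operator hm hb
  obtain ⟨p, rfl⟩ : ∃ p : ℕ → gradGraph N, u = fun n => gradGraphEquiv N (p n) :=
    ⟨fun n => (gradGraphEquiv N).symm (u n), by simp⟩
  obtain ⟨q, rfl⟩ := (gradGraphEquiv N).surjective u₀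
  simp only [isWeakSol_gradGraphEquiv_iff hm hb hM] at hu
  simp only [isWeakSolΩ_gradGraphEquiv_iff, ← mul_operator_eq_zero_iff hM hΩ hV hb] at hu₀
  have h := penalised_tendsto norm_embL2_le (norm_sq_mul_operator_le hM hV) hβ hβ_lim hlam hf hu
    hu₀.1 hu₀.2
  simp only [← formA_gradGraphEquiv hm hb hM] at h
  -- `gradGraphEquiv` is a bare bijection, but it commutes with subtraction definitionally.
  exact Real.sqrt_zero ▸ h.sqrt

lemma opA_graph (hm : Measurable V) (hb : ∃ C, ∀ x, |V x| ≤ C) (β : ℝ) :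
    (opA V hm hb β).graph = graphA V hm hb β :=
  Submodule.toLinearPMap_graph_eq _ (graphA_functional V hm hb β)

lemma opAΩ_graph (hΩ : IsOpen Ω) : (opAΩ Ω).graph = graphAΩ Ω :=
  Submodule.toLinearPMap_graph_eq _ (graphAΩ_functional hΩ)

/-- If `S` solves `A u + λ u = f` uniquely, then `-S` is the inverse of `-A - λ I`. -/
lemma isBoundedInverse_neg {E : Type*} [NormedAddCommGroup E] [NormedSpace ℝ E]
    {A : E →ₗ.[ℝ] E} {lam : ℝ} {S : E →L[ℝ] E} (hS : ∀ f, (S f, f - lam • S f) ∈ A.graph)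
    (huniq : ∀ u f, (u, f - lam • u) ∈ A.graph → u = S f) :
    IsBoundedInverse (negSub A lam) (-S) := by
  constructor
  · intro f
    -- `(-A - λ) y = f` means `A y + λ y = -f`, so the preimage is `S (-f) = -S f`.
    obtain ⟨y, hy1, hy2⟩ := (LinearPMap.mem_graph_iff A).1 (hS (-f))
    have hy3 : (-S) f = y := by rw [hy1]; simp
    refine ⟨hy3 ▸ y.2, ?_⟩
    have e : (⟨(-S) f, hy3 ▸ y.2⟩ : A.domain) = y := Subtype.ext hy3
    change -A ⟨(-S) f, _⟩ - lam • (-S) f = f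
    rw [e, hy2, hy3, hy1]
    simp
  · intro u
    have h := huniq (u : E) (A u + lam • (u : E)) (by
      rw [add_sub_cancel_right]
      exact A.mem_graph u)
    change (-S) (-A u - lam • (u : E)) = u
    rw [← neg_add', neg_apply, map_neg, neg_neg]
    exact h.symm

/-- Moving `λ u` to the other side turns `A_β u = f - λ u` into the weak equation. -/
lemma mem_graphA_iff (hm : Measurable V) (hb : ∃ C, ∀ x, |V x| ≤ C) {f u : L2 N} :
    (u, f - lam • u) ∈ graphA V hm hb β ↔ ∃ h : u ∈ H1 N, IsWeakSol V β lam f ⟨u, h⟩ := by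
  refine exists_congr fun h => forall_congr' fun φ => ?_
  rw [← inner_eq_integral, ← inner_eq_integral, inner_sub_left, real_inner_smul_left, sub_eq_iff_eq_add]
  exact eq_comm

lemma mem_graphAΩ_iff {f u : L2Ω Ω} :
    (u, f - lam • u) ∈ graphAΩ Ω ↔ ∃ h : (u : L2 N) ∈ H1 N, IsWeakSolΩ Ω lam f ⟨u, h⟩ := by
  refine exists_congr fun h => ?_
  rw [IsWeakSolΩ, and_iff_right (show (⟨u, h⟩ : H1 N) ∈ H1Ω Ω from u.2)]
  refine forall₂_congr fun φ _ => ?_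
  rw [← inner_eq_integral, ← inner_eq_integral, Submodule.coe_sub, Submodule.coe_smul,
    inner_sub_left, real_inner_smul_left, sub_eq_iff_eq_add]
  exact eq_comm

end Resolvent

/-! ### Invariance of the energy norm under sign change, and the main theorem -/

lemma formA_comm {N : ℕ} (V : RN N → ℝ) (β : ℝ) (u v : H1 N) : formA V β u v = formA V β v u := by
  rw [formA, formA, integral_inner_eq, integral_inner_eq, real_inner_comm]
  congr 2
  ext x
  ring

lemma normβ_neg {N : ℕ} (V : RN N → ℝ) (β : ℝ) (u : H1 N) : normβ V β (-u) = normβ V β u := by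
  rw [normβ, normβ, ← neg_one_smul ℝ u, formA_smul_left, formA_comm, formA_smul_left]
  simp

end WellPotential

open WellPotential in
theorem mainTheorem5
    (N : ℕ) (hN : 1 ≤ N)
    (Ω : Set (WellPotential.RN N)) (hΩo : IsOpen Ω) (hΩb : Bornology.IsBounded Ω)
    (hΩ2 : WellPotential.HasC2Boundary Ω)
    (V : WellPotential.RN N → ℝ) (hVm : Measurable V) (hVb : ∃ M, ∀ x, |V x| ≤ M)
    (hV : WellPotential.IsWellPotential Ω V)
    (β : ℕ → ℝ) (hβ : ∀ n, 0 < β n) (hβ_lim : Tendsto β atTop atTop)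
    (f : ℕ → WellPotential.L2 N) (f_lim : WellPotential.L2Ω Ω)
    (hf : Tendsto f atTop (𝓝 (f_lim : WellPotential.L2 N)))
    (lam : ℝ) (hlam : -1 < lam) :
    -- the weak solutions exist and are unique
    (∀ n, ∃! u : WellPotential.H1 N, WellPotential.IsWeakSol V (β n) lam (f n) u) ∧
    (∃! u : WellPotential.H1 N, WellPotential.IsWeakSolΩ Ω lam (f_lim : WellPotential.L2 N) u) ∧
    -- convergence of the weak solutions along a subsequence
    (∀ (u : ℕ → WellPotential.H1 N) (uΩ : WellPotential.H1 N),
      (∀ n, WellPotential.IsWeakSol V (β n) lam (f n) (u n)) →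
      WellPotential.IsWeakSolΩ Ω lam (f_lim : WellPotential.L2 N) uΩ →
      ∃ k : ℕ → ℕ, StrictMono k ∧
        Tendsto (fun j => WellPotential.normβ V (β (k j)) (u (k j) - uΩ)) atTop (𝓝 0)) ∧
    -- the resolvents exist, and they converge along the whole sequence
    (∃ (R : ℕ → WellPotential.L2 N →L[ℝ] WellPotential.L2 N)
        (RΩ : WellPotential.L2Ω Ω →L[ℝ] WellPotential.L2Ω Ω),
      (∀ n, WellPotential.IsBoundedInverse
        (WellPotential.negSub (WellPotential.opA V hVm hVb (β n)) lam) (R n)) ∧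
      WellPotential.IsBoundedInverse
        (WellPotential.negSub (WellPotential.opAΩ Ω) lam) RΩ ∧
      ∃ (w : ℕ → WellPotential.H1 N) (wΩ : WellPotential.H1 N),
        (∀ n, (w n : WellPotential.L2 N) = R n (f n)) ∧
        (wΩ : WellPotential.L2 N) = (RΩ f_lim : WellPotential.L2Ω Ω) ∧
        Tendsto (fun n => WellPotential.normβ V (β n) (w n - wΩ)) atTop (𝓝 0)) := by
  choose S hSmem hS using fun n =>
    exists_isWeakSol_operator (lam := lam) hVm hVb hV (hβ n).le hlam
  obtain ⟨SΩ, hSΩ⟩ := exists_isWeakSolΩ_operator (isClosed_L2Ω hVm hVb hΩ2 hV) hlam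
  choose hSΩmem hSΩ using hSΩ
  refine ⟨fun n => ⟨_, hS n (f n), fun v hv => hv.unique hVm hVb hV (hβ n).le hlam (hS n (f n))⟩,
    ⟨_, hSΩ f_lim, fun v hv => hv.unique hlam (hSΩ f_lim)⟩,
    -- The whole sequence converges, so the identity serves as the subsequence.
    fun u uΩ hu huΩ => ⟨id, strictMono_id,
      tendsto_normβ_sub hVm hVb hΩ2 hV hβ hβ_lim hlam hf hu huΩ⟩,
    fun n => -S n, -(SΩ ∘L (L2Ω Ω).subtypeL), fun n => ?_, ?_,
    fun n => -⟨S n (f n), hSmem n (f n)⟩, -⟨SΩ f_lim, hSΩmem f_lim⟩, fun n => rfl, rfl, ?_⟩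
  · refine isBoundedInverse_neg (fun g => ?_) fun u g h => ?_
    · rw [opA_graph, mem_graphA_iff]
      exact ⟨_, hS n g⟩
    · rw [opA_graph, mem_graphA_iff] at h
      obtain ⟨hu, h⟩ := h
      exact congrArg Subtype.val (h.unique hVm hVb hV (hβ n).le hlam (hS n g))
  · refine isBoundedInverse_neg (fun g => ?_) fun u g h => ?_
    · rw [opAΩ_graph hΩo, mem_graphAΩ_iff]
      exact ⟨_, hSΩ g⟩
    · rw [opAΩ_graph hΩo, mem_graphAΩ_iff] at h
      obtain ⟨hu, h⟩ := h
      have e := h.unique hlam (hSΩ g)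
      exact Subtype.ext (congrArg (fun v : H1 N => (v : L2 N)) e)
  -- Both resolvents are the negatives of the solution operators, so the difference only changes
  -- sign.
  · have h := tendsto_normβ_sub hVm hVb hΩ2 hV hβ hβ_lim hlam hf (fun n => hS n (f n))
      (hSΩ f_lim)
    refine h.congr fun n => ?_
    rw [neg_sub_neg, ← neg_sub]
    exact normβ_neg _ _ _
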